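/- Let $J=\{1,\dots,n\}$ be a set of jobs with volumes $v_j>0$, pairwise distinct, and resource requirements $r_j\in(0,1]$. Consider the continuous linear program $$\text{minimize } \sum_{j}\int_0^\infty \frac{t\,R_j(t)}{v_j}\,dt\quad\text{s.t.}\quad \int_0^\infty R_j(t)\,dt\ge v_j,\qquad 0\le R_j(t)\le r_j,\qquad \sum_{j}R_j(t)\le 1\qquad (j\in J,\ t\ge 0)$$ over integrable $R_j$, and its dual $$\text{maximize } \sum_j\alpha_jv_j-\sum_jr_j\int_0^\infty\beta_j(t)\,dt-\int_0^\infty\gamma(t)\,dt\quad\text{s.t.}\quad \alpha_j,\beta_j(t),\gamma(t)\ge 0,\qquad \gamma(t)+\beta_j(t)\ge\alpha_j-\frac{t}{v_j}\qquad (j\in J,\ t\ge 0)$$ with $\beta_j,\gamma$ integrable. A *primal-dual pair* is a tuple $(R,\alpha,\beta,\gamma)$ of feasible solutions that fulfils, for all $j\in J$ and $t\ge0$, the slackness conditions $\alpha_j\bigl(v_j-\int_0^\infty R_j\bigr)=0$, $\beta_j(t)(r_j-R_j(t))=0$, $\gamma(t)\bigl(1-\sum_jR_j(t)\bigr)=0$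 and $R_j(t)\bigl(\alpha_j-t/v_j-\beta_j(t)-\gamma(t)\bigr)=0$. For $\alpha\in\mathbb R^n$ let $d_j(t)=\alpha_j-t/v_j$, and write $i\succ_t j$ if $d_i(t)>d_j(t)$, or $d_i(t)=d_j(t)$ and $v_i>v_j$. The *line schedule* of $\alpha$ is the tuple $(R,\alpha,\beta,\gamma)$ given, recursively along $\succ_t$, by $$R_j(t)=\begin{cases}\min\bigl(r_j,\,1-\sum_{i\succ_t j}R_i(t)\bigr)&\text{if } d_j(t)>0,\\ 0&\text{otherwise,}\end{cases}\qquad \beta_j(t)=\max\bigl(0,d_j(t)-\gamma(t)\bigr),$$ where $\gamma(t)=\max(0,d_j(t))$ for the smallest job $j$ according to $\succ_t$ with $R_j(t)>0$ if $\sum_jR_j(t)=1$, and $\gamma(t)=0$ if $\sum_jR_j(t)\neq 1$. Algorithm LS outputs the schedule $R$ of a line schedule of some $\alpha\ge 0$ with $\int_0^\infty R_j(t)\,dt=v_j$ for all $j\in J$. Then: 1. such an $\alpha$ exists; 2. for every such $\alpha$, the line schedule $(R,\alpha,\beta,\gamma)$ of $\alpha$ is a primal-dual pair, and, with $$P=\sum_j\int_0^\infty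 \frac{t\,R_j(t)}{v_j}\,dt,\qquad A=\sum_j\alpha_jv_j,\qquad B=\sum_jr_j\int_0^\infty\beta_j(t)\,dt,\qquad \Gamma=\int_0^\infty\gamma(t)\,dt$$ (all integrals being finite), it fulfils strong duality $A=B+\Gamma+P$ and balancedness $P=B+\Gamma$. -/

import Mathlib

open MeasureTheory Set

/-- A set of `n` jobs sharing one resource: job `j` has a processing volume `v j > 0` and a
resource requirement `r j ∈ (0, 1]`. -/
structure JobSet (n : ℕ) where
  v : Fin n → ℝ
  r : Fin n → ℝ
  v_pos : ∀ j, 0 < v j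
  r_pos : ∀ j, 0 < r j
  r_le_one : ∀ j, r j ≤ 1

namespace JobSet

variable {n : ℕ} (J : JobSet n)

/-- All volumes are pairwise distinct. -/
def NonDegenerate : Prop := ∀ i j, i ≠ j → J.v i ≠ J.v j

/-! ### The continuous linear program and its dual

Functions of time are functions `ℝ → ℝ` of which only the values at `t ≥ 0` matter. -/

/-- `R` is a feasible schedule (a feasible point of the primal program). -/
structure PrimalFeasible (R : Fin n → ℝ → ℝ) : Prop where
  integrable : ∀ j, IntegrableOn (R j) (Ioi 0)
  nonneg : ∀ j, ∀ t, 0 ≤ t → 0 ≤ R j t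
  le_req : ∀ j, ∀ t, 0 ≤ t → R j t ≤ J.r j
  total_le_one : ∀ t, 0 ≤ t → ∑ j, R j t ≤ 1
  volume : ∀ j, J.v j ≤ ∫ t in Ioi (0 : ℝ), R j t

/-- `(α, β, γ)` is a feasible point of the dual program. -/
structure DualFeasible (α : Fin n → ℝ) (β : Fin n → ℝ → ℝ) (γ : ℝ → ℝ) : Prop where
  α_nonneg : ∀ j, 0 ≤ α j
  β_nonneg : ∀ j, ∀ t, 0 ≤ t → 0 ≤ β j t
  γ_nonneg : ∀ t, 0 ≤ t → 0 ≤ γ t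
  β_integrable : ∀ j, IntegrableOn (β j) (Ioi 0)
  γ_integrable : IntegrableOn γ (Ioi 0)
  constr : ∀ j, ∀ t, 0 ≤ t → α j - t / J.v j ≤ γ t + β j t

/-- A primal-dual pair: feasible solutions of both programs that fulfil the four slackness
conditions. -/
structure IsPrimalDualPair (R : Fin n → ℝ → ℝ) (α : Fin n → ℝ) (β : Fin n → ℝ → ℝ)
    (γ : ℝ → ℝ) : Prop where
  primal : J.PrimalFeasible R
  dual : J.DualFeasible α β γ
  α_slack : ∀ j, α j * (J.v j - ∫ t in Ioi (0 : ℝ), R j t) = 0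
  β_slack : ∀ j, ∀ t, 0 ≤ t → β j t * (J.r j - R j t) = 0
  γ_slack : ∀ t, 0 ≤ t → γ t * (1 - ∑ j, R j t) = 0
  R_slack : ∀ j, ∀ t, 0 ≤ t → R j t * (α j - t / J.v j - β j t - γ t) = 0

/-- `P`, the primal objective (the total fractional completion time of `R`). -/
noncomputable def objP (R : Fin n → ℝ → ℝ) : ℝ :=
  ∑ j, ∫ t in Ioi (0 : ℝ), t * R j t / J.v j

/-- `A`, the first part of the dual objective `A - B - Γ`. -/
noncomputable def objA (α : Fin n → ℝ) : ℝ := ∑ j, α j * J.v j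

/-- `B`, the second part of the dual objective `A - B - Γ`. -/
noncomputable def objB (β : Fin n → ℝ → ℝ) : ℝ :=
  ∑ j, J.r j * ∫ t in Ioi (0 : ℝ), β j t

/-- `Γ`, the third part of the dual objective `A - B - Γ`. -/
noncomputable def objΓ (γ : ℝ → ℝ) : ℝ := ∫ t in Ioi (0 : ℝ), γ t

/-! ### Line schedules -/

/-- The dual line `d_j(t) = α_j - t / v_j`. -/
noncomputable def dualLine (α : Fin n → ℝ) (j : Fin n) (t : ℝ) : ℝ := α j - t / J.v j

/-- `i ≻_t j`: at time `t` job `i` has higher priority than job `j`. -/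
def Higher (α : Fin n → ℝ) (t : ℝ) (i j : Fin n) : Prop :=
  J.dualLine α j t < J.dualLine α i t ∨
    (J.dualLine α i t = J.dualLine α j t ∧ J.v j < J.v i)

theorem Higher.trans {J : JobSet n} {α : Fin n → ℝ} {t : ℝ} {i j k : Fin n}
    (h₁ : J.Higher α t i j) (h₂ : J.Higher α t j k) : J.Higher α t i k := by
  unfold Higher at *
  grind

theorem Higher.irrefl {J : JobSet n} {α : Fin n → ℝ} {t : ℝ} {i : Fin n} :
    ¬ J.Higher α t i i := by
  unfold Higher
  grind

open Classical in
/-- The jobs of higher priority than `j` at time `t`. -/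
noncomputable def above (α : Fin n → ℝ) (t : ℝ) (j : Fin n) : Finset (Fin n) :=
  Finset.univ.filter fun i => J.Higher α t i j

theorem mem_above {J : JobSet n} {α : Fin n → ℝ} {t : ℝ} {i j : Fin n} :
    i ∈ J.above α t j ↔ J.Higher α t i j := by
  simp [above]

theorem card_above_lt {J : JobSet n} {α : Fin n → ℝ} {t : ℝ} {i j : Fin n}
    (h : i ∈ J.above α t j) : (J.above α t i).card < (J.above α t j).card := by
  apply Finset.card_lt_card
  refine ⟨fun k hk => ?_, fun hs => ?_⟩
  · exact mem_above.2 ((mem_above.1 hk).trans (mem_above.1 h))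
  · exact Higher.irrefl (mem_above.1 (hs h))

open Classical in
/-- The resource assignment of the line schedule of `α`, by recursion along the priority order;
see `lineR_eq` for the recursive equation. -/
noncomputable def lineR (α : Fin n → ℝ) (j : Fin n) (t : ℝ) : ℝ :=
  if 0 < J.dualLine α j t then
    min (J.r j) (1 - ∑ i ∈ (J.above α t j).attach, lineR α i.1 t)
  else 0
termination_by (J.above α t j).card
decreasing_by exact card_above_lt i.2

open Classical in
theorem lineR_eq (α : Fin n → ℝ) (j : Fin n) (t : ℝ) :
    J.lineR α j t = if 0 < J.dualLine α j t then
      min (J.r j) (1 - ∑ i ∈ J.above α t j, J.lineR α i t) else 0 := by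
  rw [lineR, Finset.sum_attach (J.above α t j) fun i => J.lineR α i t]

/-- `j` is the smallest job according to `≻_t` among the jobs scheduled at time `t`. -/
def IsLowestScheduled (α : Fin n → ℝ) (t : ℝ) (j : Fin n) : Prop :=
  0 < J.lineR α j t ∧ ∀ i, 0 < J.lineR α i t → i ≠ j → J.Higher α t i j

open Classical in
/-- The dual function `γ` of the line schedule of `α`: where the resource is fully used it is
`max 0 (d_j(t))` for the smallest scheduled job `j`, and it is `0` where resource is left over
(so that the idle resource, as a job with dual line `0`, counts as scheduled there). -/
noncomputable def lineγ (α : Fin n → ℝ) (t : ℝ) : ℝ :=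
  if h : ∑ j, J.lineR α j t = 1 ∧ ∃ j, J.IsLowestScheduled α t j then
    max 0 (J.dualLine α h.2.choose t)
  else 0

/-- The dual functions `β_j` of the line schedule of `α`. -/
noncomputable def lineβ (α : Fin n → ℝ) (j : Fin n) (t : ℝ) : ℝ :=
  max 0 (J.dualLine α j t - J.lineγ α t)

/-- `α` is a vector of nonnegative dual values whose line schedule processes exactly the volume
`v_j` of every job `j`. Algorithm LS outputs the line schedule of such a vector. -/
def IsLSVector (α : Fin n → ℝ) : Prop :=
  (∀ j, 0 ≤ α j) ∧
    ∀ j, IntegrableOn (J.lineR α j) (Ioi 0) ∧ ∫ t in Ioi (0 : ℝ), J.lineR α j t = J.v j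

end JobSet

/-! At each time the line schedule solves a fractional knapsack with item values `d_j(t)`, and `β`,
`γ` are its dual solution. Pointwise slackness therefore makes its value `W(t) = ∑ R_j d_j` equal to
`∑ r_j β_j + γ` (`sum_lineR_mul_dualLine`), so `∫ W = B + Γ`. When the volumes are exact, also `∫ W
= A - P`, and strong duality follows from balancedness.

Balancedness is a first-order optimality condition under time scaling. The assignment `R(t)`
competes at time `ct` and earns at most `W(ct)`. Integrating gives `∫ W - (c - 1) P ≤ c⁻¹ ∫ W` for
every `c > 0` (`rescaling_inequality`), and `c → 1` from both sides forces `P = ∫ W`.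

For existence, maximize `∑ α_j` over the compact set `underfull`. If some job were short of its
volume, raising its `α_j` slightly would keep it within its volume by continuity
(`continuous_lineVolume`) and only take resource from the others (`lineVolume_anti`), contradicting
maximality. -/

namespace JobSet

/-! ### Priority order, greedy assignment and slackness at a fixed time -/

section Pointwise

variable {n : ℕ} {J : JobSet n} {α : Fin n → ℝ} {t : ℝ}

theorem Higher.total (hJ : J.NonDegenerate) {i j : Fin n} (h : i ≠ j) :
    J.Higher α t i j ∨ J.Higher α t j i := by
  have := hJ i j h
  unfold Higher
  grind

theorem Higher.dualLine_le {i j : Fin n} (h : J.Higher α t i j) :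
    J.dualLine α j t ≤ J.dualLine α i t := by
  unfold Higher at h
  grind

/-- Every nonempty set of jobs has a job of lowest priority. -/
theorem exists_lowest (hJ : J.NonDegenerate) (α : Fin n → ℝ) (t : ℝ) {s : Finset (Fin n)}
    (hs : s.Nonempty) : ∃ k ∈ s, ∀ i ∈ s, i ≠ k → J.Higher α t i k := by
  obtain ⟨k, hk, hmax⟩ := s.exists_max_image (fun i => (J.above α t i).card) hs
  refine ⟨k, hk, fun i hi hik => ?_⟩
  rcases Higher.total (α := α) (t := t) hJ hik with h | h
  · exact h
  · exact absurd (card_above_lt (mem_above.2 h)) (not_lt.2 (hmax i hi))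

theorem notMem_above_self {j : Fin n} : j ∉ J.above α t j :=
  fun h => Higher.irrefl (mem_above.1 h)

theorem lineR_of_nonpos {j : Fin n} (h : J.dualLine α j t ≤ 0) : J.lineR α j t = 0 := by
  rw [lineR_eq, if_neg (not_lt.2 h)]

theorem lineR_of_pos {j : Fin n} (h : 0 < J.dualLine α j t) :
    J.lineR α j t = min (J.r j) (1 - ∑ i ∈ J.above α t j, J.lineR α i t) := by
  rw [lineR_eq, if_pos h]

theorem dualLine_pos_of_lineR_pos {j : Fin n} (h : 0 < J.lineR α j t) :
    0 < J.dualLine α j t := by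
  by_contra h'
  rw [lineR_of_nonpos (not_lt.1 h')] at h
  exact lt_irrefl _ h

/-- Every job above `j` has a positive line too, so the greedy rule hands out resource until demand
or capacity is exhausted. The induction peels off the lowest job `k` above `j`; what remains is
exactly the set above `k`. -/
theorem sum_above_lineR (hJ : J.NonDegenerate) {j : Fin n} (hj : 0 < J.dualLine α j t) :
    ∑ i ∈ J.above α t j, J.lineR α i t = min 1 (∑ i ∈ J.above α t j, J.r i) := by
  induction hm : (J.above α t j).card using Nat.strong_induction_on generalizing j with
  | _ m ih =>
    rcases (J.above α t j).eq_empty_or_nonempty with he | hne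
    · simp [he]
    · obtain ⟨k, hk, hlow⟩ := exists_lowest hJ α t hne
      have hins : J.above α t j = insert k (J.above α t k) := by
        ext i
        rw [Finset.mem_insert]
        constructor
        · intro hi
          by_cases hik : i = k
          · exact Or.inl hik
          · exact Or.inr (mem_above.2 (hlow i hi hik))
        · rintro (rfl | hi)
          · exact hk
          · exact mem_above.2 ((mem_above.1 hi).trans (mem_above.1 hk))
      have hkpos : 0 < J.dualLine α k t := hj.trans_le (mem_above.1 hk).dualLine_le
      have h := ih _ (hm ▸ card_above_lt hk) hkpos rfl
      rw [hins, Finset.sum_insert notMem_above_self, Finset.sum_insert notMem_above_self,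
        lineR_of_pos hkpos, h]
      have := J.r_pos k
      grind

/-- The resource assignment of a line schedule in closed form. -/
theorem lineR_closed (hJ : J.NonDegenerate) (α : Fin n → ℝ) (j : Fin n) (t : ℝ) :
    J.lineR α j t = if 0 < J.dualLine α j t then
      min (J.r j) (1 - min 1 (∑ i ∈ J.above α t j, J.r i)) else 0 := by
  split_ifs with h
  · rw [lineR_of_pos h, sum_above_lineR hJ h]
  · exact lineR_of_nonpos (not_lt.1 h)

theorem lineR_nonneg (hJ : J.NonDegenerate) (α : Fin n → ℝ) (j : Fin n) (t : ℝ) :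
    0 ≤ J.lineR α j t := by
  rw [lineR_closed hJ]
  have := J.r_pos j
  grind

theorem lineR_le (hJ : J.NonDegenerate) (α : Fin n → ℝ) (j : Fin n) (t : ℝ) :
    J.lineR α j t ≤ J.r j := by
  rw [lineR_closed hJ]
  have := J.r_pos j
  grind

theorem sum_lineR_le_one (hJ : J.NonDegenerate) (α : Fin n → ℝ) (t : ℝ) :
    ∑ j, J.lineR α j t ≤ 1 := by
  classical
  rw [← Finset.sum_filter_add_sum_filter_not _ (fun j => 0 < J.dualLine α j t),
    Finset.sum_eq_zero (s := Finset.univ.filter fun j => ¬ 0 < J.dualLine α j t)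
      (fun j hj => lineR_of_nonpos (not_lt.1 (Finset.mem_filter.1 hj).2)), add_zero]
  rcases (Finset.univ.filter fun j => 0 < J.dualLine α j t).eq_empty_or_nonempty with he | hne
  · simp [he]
  · obtain ⟨k, hk, hlow⟩ := exists_lowest hJ α t hne
    -- The lowest job with positive line was capped by what the jobs above it left over, and these
    -- together are all the jobs that can receive resource.
    have hkpos := (Finset.mem_filter.1 hk).2
    have hsub : (Finset.univ.filter fun j => 0 < J.dualLine α j t) ⊆
        insert k (J.above α t k) := by
      intro i hi
      by_cases hik : i = k
      · exact Finset.mem_insert.2 (Or.inl hik)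
      · exact Finset.mem_insert_of_mem (mem_above.2 (hlow i hi hik))
    refine (Finset.sum_le_sum_of_subset_of_nonneg hsub
      fun i _ _ => lineR_nonneg hJ α i t).trans ?_
    rw [Finset.sum_insert notMem_above_self, lineR_of_pos hkpos]
    linarith [min_le_right (J.r k) (1 - ∑ i ∈ J.above α t k, J.lineR α i t)]

/-- A job with positive dual line that does not get its full requirement exhausts the resource
together with the jobs above it. -/
theorem lineR_eq_or_sum_eq_one {j : Fin n} (h : 0 < J.dualLine α j t) :
    J.lineR α j t = J.r j ∨ ∑ i ∈ insert j (J.above α t j), J.lineR α i t = 1 := by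
  rw [Finset.sum_insert notMem_above_self]
  have := lineR_of_pos h
  grind

theorem sum_lineR_eq_one_of_ne (hJ : J.NonDegenerate) {j : Fin n} (h : 0 < J.dualLine α j t)
    (hne : J.lineR α j t ≠ J.r j) :
    ∑ i, J.lineR α i t = 1 ∧ ∀ i, J.Higher α t j i → J.lineR α i t = 0 := by
  have hsum := (lineR_eq_or_sum_eq_one h).resolve_left hne
  have hle := sum_lineR_le_one hJ α t
  have hsplit := Finset.sum_add_sum_compl (insert j (J.above α t j)) fun i => J.lineR α i t
  have hnn : ∀ i ∈ (insert j (J.above α t j))ᶜ, 0 ≤ J.lineR α i t :=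
    fun i _ => lineR_nonneg hJ α i t
  have hc : ∑ i ∈ (insert j (J.above α t j))ᶜ, J.lineR α i t = 0 :=
    le_antisymm (by linarith) (Finset.sum_nonneg hnn)
  refine ⟨by linarith, fun i hi => (Finset.sum_eq_zero_iff_of_nonneg hnn).1 hc i ?_⟩
  rw [Finset.mem_compl, Finset.mem_insert, mem_above]
  rintro (rfl | h')
  · exact Higher.irrefl hi
  · exact Higher.irrefl (hi.trans h')

theorem le_sum_lineR (hJ : J.NonDegenerate) {j : Fin n} (h : 0 < J.dualLine α j t) :
    J.r j ≤ ∑ i, J.lineR α i t := by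
  by_cases hne : J.lineR α j t = J.r j
  · rw [← hne]
    exact Finset.single_le_sum (fun i _ => lineR_nonneg hJ α i t) (Finset.mem_univ j)
  · rw [(sum_lineR_eq_one_of_ne hJ h hne).1]
    exact J.r_le_one j

/-- Makes the choice inside `lineγ` harmless. -/
theorem IsLowestScheduled.unique {i j : Fin n} (hi : J.IsLowestScheduled α t i)
    (hj : J.IsLowestScheduled α t j) : i = j := by
  by_contra h
  exact Higher.irrefl ((hj.2 i hi.1 h).trans (hi.2 j hj.1 (Ne.symm h)))

theorem exists_isLowestScheduled (hJ : J.NonDegenerate) (h : ∑ j, J.lineR α j t = 1) :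
    ∃ j, J.IsLowestScheduled α t j := by
  classical
  have hne : (Finset.univ.filter fun j => 0 < J.lineR α j t).Nonempty := by
    obtain ⟨j, _, hj⟩ := Finset.exists_ne_zero_of_sum_ne_zero (h.trans_ne one_ne_zero)
    exact ⟨j, by simpa using lt_of_le_of_ne (lineR_nonneg hJ α j t) (Ne.symm hj)⟩
  obtain ⟨k, hk, hlow⟩ := exists_lowest hJ α t hne
  exact ⟨k, (Finset.mem_filter.1 hk).2, fun i hi hik => hlow i (by simpa using hi) hik⟩

theorem IsLowestScheduled.lineγ_eq {j : Fin n} (hj : J.IsLowestScheduled α t j)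
    (h : ∑ j, J.lineR α j t = 1) : J.lineγ α t = J.dualLine α j t := by
  have h' : ∑ j, J.lineR α j t = 1 ∧ ∃ j, J.IsLowestScheduled α t j := ⟨h, j, hj⟩
  rw [lineγ, dif_pos h', h'.2.choose_spec.unique hj]
  exact max_eq_right (dualLine_pos_of_lineR_pos hj.1).le

theorem lineγ_of_ne (h : ∑ j, J.lineR α j t ≠ 1) : J.lineγ α t = 0 := by
  rw [lineγ, dif_neg fun h' => h h'.1]

theorem lineγ_nonneg : 0 ≤ J.lineγ α t := by
  unfold lineγ
  split_ifs
  · exact le_max_left _ _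
  · exact le_rfl

theorem lineβ_nonneg {j : Fin n} : 0 ≤ J.lineβ α j t := le_max_left _ _

theorem dualLine_le_lineγ_add_lineβ {j : Fin n} :
    J.dualLine α j t ≤ J.lineγ α t + J.lineβ α j t := by
  have := le_max_right 0 (J.dualLine α j t - J.lineγ α t)
  unfold lineβ
  linarith

/-- If `j` has positive `β` but is not fully served, the resource is exhausted and nothing below `j`
is scheduled. But then `γ` is the line of the lowest scheduled job, which lies strictly below `d_j`.
-/
theorem lineβ_mul_sub (hJ : J.NonDegenerate) (α : Fin n → ℝ) (j : Fin n) (t : ℝ) :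
    J.lineβ α j t * (J.r j - J.lineR α j t) = 0 := by
  by_contra h
  obtain ⟨hβ, hR⟩ := mul_ne_zero_iff.1 h
  have hlt : J.lineγ α t < J.dualLine α j t := by
    by_contra h'
    exact hβ (max_eq_left (by linarith))
  have hpos : 0 < J.dualLine α j t := lineγ_nonneg.trans_lt hlt
  obtain ⟨hsum, hzero⟩ := sum_lineR_eq_one_of_ne hJ hpos fun h' => hR (by rw [h', sub_self])
  obtain ⟨k, hk⟩ := exists_isLowestScheduled hJ hsum
  rw [hk.lineγ_eq hsum] at hlt
  exact hk.1.ne' (hzero k (Or.inl hlt))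

theorem lineγ_mul_sub (α : Fin n → ℝ) (t : ℝ) :
    J.lineγ α t * (1 - ∑ j, J.lineR α j t) = 0 := by
  by_cases h : ∑ j, J.lineR α j t = 1
  · rw [h, sub_self, mul_zero]
  · rw [lineγ_of_ne h, zero_mul]

theorem lineR_mul_sub (hJ : J.NonDegenerate) (α : Fin n → ℝ) (j : Fin n) (t : ℝ) :
    J.lineR α j t * (J.dualLine α j t - J.lineβ α j t - J.lineγ α t) = 0 := by
  rcases (lineR_nonneg hJ α j t).eq_or_lt with h0 | hpos
  · rw [← h0, zero_mul]
  · have hle : J.lineγ α t ≤ J.dualLine α j t := by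
      by_cases h : ∑ j, J.lineR α j t = 1
      · obtain ⟨k, hk⟩ := exists_isLowestScheduled hJ h
        rw [hk.lineγ_eq h]
        by_cases hjk : j = k
        · rw [hjk]
        · exact (hk.2 j hpos hjk).dualLine_le
      · rw [lineγ_of_ne h]
        exact (dualLine_pos_of_lineR_pos hpos).le
    rw [lineβ, max_eq_right (by linarith)]
    ring

/-- The value of the resource at time `t` under a line schedule, in terms of the dual variables. -/
theorem sum_lineR_mul_dualLine (hJ : J.NonDegenerate) (α : Fin n → ℝ) (t : ℝ) :
    ∑ j, J.lineR α j t * J.dualLine α j t = ∑ j, J.r j * J.lineβ α j t + J.lineγ α t := by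
  have h : ∀ j, J.lineR α j t * J.dualLine α j t =
      J.r j * J.lineβ α j t + J.lineγ α t * J.lineR α j t := fun j => by
    linear_combination lineR_mul_sub hJ α j t - lineβ_mul_sub hJ α j t
  rw [Finset.sum_congr rfl fun j _ => h j, Finset.sum_add_distrib, ← Finset.mul_sum]
  linear_combination -lineγ_mul_sub (J := J) α t

/-- The line schedule maximizes the total dual value of the processed resource at any time. -/
theorem sum_mul_dualLine_le (hJ : J.NonDegenerate) (α : Fin n → ℝ) (t : ℝ) {x : Fin n → ℝ}
    (h0 : ∀ j, 0 ≤ x j) (hr : ∀ j, x j ≤ J.r j) (h1 : ∑ j, x j ≤ 1) :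
    ∑ j, x j * J.dualLine α j t ≤ ∑ j, J.lineR α j t * J.dualLine α j t := by
  rw [sum_lineR_mul_dualLine hJ]
  calc ∑ j, x j * J.dualLine α j t
      ≤ ∑ j, (J.r j * J.lineβ α j t + J.lineγ α t * x j) := by
        refine Finset.sum_le_sum fun j _ => ?_
        have h2 := mul_le_mul_of_nonneg_left
          (dualLine_le_lineγ_add_lineβ (J := J) (α := α) (t := t) (j := j)) (h0 j)
        have h3 := mul_le_mul_of_nonneg_right (hr j)
          (lineβ_nonneg (J := J) (α := α) (t := t) (j := j))
        linarith
    _ ≤ _ := by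
        rw [Finset.sum_add_distrib, ← Finset.mul_sum]
        have := mul_le_mul_of_nonneg_left h1 (lineγ_nonneg (J := J) (α := α) (t := t))
        linarith

end Pointwise

/-! ### Measurability and integrability of line schedules -/

section Integrability

variable {n : ℕ} {J : JobSet n} {α : Fin n → ℝ}

theorem measurable_dualLine (α : Fin n → ℝ) (j : Fin n) : Measurable (J.dualLine α j) := by
  unfold dualLine
  fun_prop

theorem measurableSet_higher (α : Fin n → ℝ) (i j : Fin n) :
    MeasurableSet {t | J.Higher α t i j} := by
  unfold Higher
  exact (measurableSet_lt (measurable_dualLine α j) (measurable_dualLine α i)).union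
    ((measurableSet_eq_fun (measurable_dualLine α i) (measurable_dualLine α j)).inter
      (MeasurableSet.const _))

theorem measurable_lineR (hJ : J.NonDegenerate) (α : Fin n → ℝ) (j : Fin n) :
    Measurable (J.lineR α j) := by
  classical
  have h : J.lineR α j = fun t => if 0 < J.dualLine α j t then
      min (J.r j) (1 - min 1 (∑ i, if J.Higher α t i j then J.r i else 0)) else 0 := by
    funext t
    rw [lineR_closed hJ, above, Finset.sum_filter]
  rw [h]
  refine Measurable.ite (measurableSet_lt measurable_const (measurable_dualLine α j)) ?_
    measurable_const
  refine measurable_const.min (measurable_const.sub (measurable_const.min ?_))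
  exact Finset.measurable_fun_sum _ fun i _ =>
    Measurable.ite (measurableSet_higher α i j) measurable_const measurable_const

theorem measurableSet_isLowestScheduled (hJ : J.NonDegenerate) (α : Fin n → ℝ) (j : Fin n) :
    MeasurableSet {t | J.IsLowestScheduled α t j} := by
  unfold IsLowestScheduled
  refine (measurableSet_lt measurable_const (measurable_lineR hJ α j)).inter
    (Measurable.forall fun i => ?_).setOf
  exact Measurable.imp (measurableSet_lt measurable_const (measurable_lineR hJ α i)).mem
    (Measurable.imp measurable_const (measurableSet_higher α i j).mem)

theorem measurable_lineγ (hJ : J.NonDegenerate) (α : Fin n → ℝ) : Measurable (J.lineγ α) := by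
  classical
  have h : J.lineγ α = fun t => if ∑ j, J.lineR α j t = 1 then
      ∑ j, (if J.IsLowestScheduled α t j then J.dualLine α j t else 0) else 0 := by
    funext t
    split_ifs with h
    · obtain ⟨k, hk⟩ := exists_isLowestScheduled hJ h
      rw [hk.lineγ_eq h, Finset.sum_eq_single k]
      · rw [if_pos hk]
      · exact fun i _ hik => if_neg fun hi => hik (hi.unique hk)
      · exact fun h => absurd (Finset.mem_univ k) h
    · exact lineγ_of_ne h
  rw [h]
  refine Measurable.ite (measurableSet_eq_fun
    (Finset.measurable_fun_sum _ fun j _ => measurable_lineR hJ α j) measurable_const) ?_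
    measurable_const
  exact Finset.measurable_fun_sum _ fun j _ =>
    Measurable.ite (measurableSet_isLowestScheduled hJ α j) (measurable_dualLine α j)
      measurable_const

theorem measurable_lineβ (hJ : J.NonDegenerate) (α : Fin n → ℝ) (j : Fin n) :
    Measurable (J.lineβ α j) :=
  measurable_const.max ((measurable_dualLine α j).sub (measurable_lineγ hJ α))

theorem integrableOn_Ioi_of_bounded {f : ℝ → ℝ} (hf : Measurable f) {C T : ℝ}
    (hb : ∀ t, 0 < t → t ≤ T → |f t| ≤ C) (h0 : ∀ t, 0 < t → T < t → f t = 0) :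
    IntegrableOn f (Ioi 0) := by
  have h : IntegrableOn f (Ioc 0 T) := by
    refine Measure.integrableOn_of_bounded (M := C) measure_Ioc_lt_top.ne
      hf.aestronglyMeasurable ?_
    exact (ae_restrict_iff' measurableSet_Ioc).2 (Filter.Eventually.of_forall
      fun t ht => hb t ht.1 ht.2)
  refine h.of_forall_sdiff_eq_zero measurableSet_Ioi fun t ht => ?_
  exact h0 t ht.1 (not_le.1 fun h' => ht.2 ⟨ht.1, h'⟩)

theorem dualLine_pos_iff {j : Fin n} {t : ℝ} : 0 < J.dualLine α j t ↔ t < α j * J.v j := by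
  rw [dualLine, sub_pos, div_lt_iff₀ (J.v_pos j)]

theorem dualLine_le {j : Fin n} {t : ℝ} (ht : 0 ≤ t) : J.dualLine α j t ≤ α j := by
  have := div_nonneg ht (J.v_pos j).le
  unfold dualLine
  linarith

theorem integrableOn_lineR (hJ : J.NonDegenerate) (α : Fin n → ℝ) (j : Fin n) :
    IntegrableOn (J.lineR α j) (Ioi 0) := by
  refine integrableOn_Ioi_of_bounded (C := J.r j) (T := α j * J.v j) (measurable_lineR hJ α j)
    (fun t _ _ => ?_) fun t _ h => ?_
  · rw [abs_of_nonneg (lineR_nonneg hJ α j t)]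
    exact lineR_le hJ α j t
  · exact lineR_of_nonpos (not_lt.1 fun h' => h.not_gt (dualLine_pos_iff.1 h'))

theorem integrableOn_mul_lineR (hJ : J.NonDegenerate) (α : Fin n → ℝ) (j : Fin n) :
    IntegrableOn (fun t => t * J.lineR α j t / J.v j) (Ioi 0) := by
  refine integrableOn_Ioi_of_bounded (C := α j * J.v j * J.r j / J.v j) (T := α j * J.v j)
    ((measurable_id.mul (measurable_lineR hJ α j)).div_const _) (fun t ht hT => ?_)
    fun t _ h => ?_
  · have := J.v_pos j
    have := J.r_pos j
    have := lineR_nonneg hJ α j t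
    have := lineR_le hJ α j t
    rw [abs_of_nonneg (by positivity)]
    have := ht.le.trans hT
    gcongr
  · rw [lineR_of_nonpos (not_lt.1 fun h' => h.not_gt (dualLine_pos_iff.1 h')), mul_zero, zero_div]

theorem lineβ_le {j : Fin n} {t : ℝ} : J.lineβ α j t ≤ max 0 (J.dualLine α j t) :=
  max_le_max le_rfl (sub_le_self _ lineγ_nonneg)

theorem integrableOn_lineβ (hJ : J.NonDegenerate) (α : Fin n → ℝ) (j : Fin n) :
    IntegrableOn (J.lineβ α j) (Ioi 0) := by
  refine integrableOn_Ioi_of_bounded (C := max 0 (α j)) (T := α j * J.v j)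
    (measurable_lineβ hJ α j) (fun t ht _ => ?_) fun t _ h => ?_
  · rw [abs_of_nonneg lineβ_nonneg]
    exact lineβ_le.trans (max_le_max le_rfl (dualLine_le ht.le))
  · refine le_antisymm (lineβ_le.trans (max_le le_rfl ?_)) lineβ_nonneg
    exact not_lt.1 fun h' => h.not_gt (dualLine_pos_iff.1 h')

theorem lineγ_eq_zero_or (hJ : J.NonDegenerate) (α : Fin n → ℝ) (t : ℝ) :
    J.lineγ α t = 0 ∨ ∃ j, 0 < J.dualLine α j t ∧ J.lineγ α t = J.dualLine α j t := by
  by_cases h : ∑ j, J.lineR α j t = 1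
  · obtain ⟨k, hk⟩ := exists_isLowestScheduled hJ h
    exact Or.inr ⟨k, dualLine_pos_of_lineR_pos hk.1, hk.lineγ_eq h⟩
  · exact Or.inl (lineγ_of_ne h)

theorem integrableOn_lineγ (hJ : J.NonDegenerate) (α : Fin n → ℝ) :
    IntegrableOn (J.lineγ α) (Ioi 0) := by
  -- The sums serve as crude maxima over all jobs; past `T` every dual line is nonpositive.
  refine integrableOn_Ioi_of_bounded (C := ∑ j, |α j|) (T := ∑ j, |α j * J.v j|)
    (measurable_lineγ hJ α) (fun t ht _ => ?_) fun t _ h => ?_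
  · rw [abs_of_nonneg lineγ_nonneg]
    rcases lineγ_eq_zero_or hJ α t with h | ⟨j, -, h⟩
    · rw [h]
      positivity
    · rw [h]
      exact ((dualLine_le ht.le).trans (le_abs_self _)).trans
        (Finset.single_le_sum (f := fun j => |α j|) (fun i _ => abs_nonneg _) (Finset.mem_univ j))
  · rcases lineγ_eq_zero_or hJ α t with h' | ⟨j, hj, -⟩
    · exact h'
    · refine absurd (dualLine_pos_iff.1 hj) (not_lt.2 (le_trans ?_ h.le))
      exact (le_abs_self _).trans (Finset.single_le_sum (f := fun j => |α j * J.v j|)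
        (fun i _ => abs_nonneg _) (Finset.mem_univ j))

end Integrability

/-! ### Strong duality and balancedness -/

section Duality

variable {n : ℕ} {J : JobSet n} {α : Fin n → ℝ}

theorem IsLSVector.isPrimalDualPair (hJ : J.NonDegenerate) (hα : J.IsLSVector α) :
    J.IsPrimalDualPair (J.lineR α) α (J.lineβ α) (J.lineγ α) where
  primal :=
    { integrable := fun j => (hα.2 j).1
      nonneg := fun j t _ => lineR_nonneg hJ α j t
      le_req := fun j t _ => lineR_le hJ α j t
      total_le_one := fun t _ => sum_lineR_le_one hJ α t
      volume := fun j => (hα.2 j).2.ge }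
  dual :=
    { α_nonneg := hα.1
      β_nonneg := fun _ _ _ => lineβ_nonneg
      γ_nonneg := fun _ _ => lineγ_nonneg
      β_integrable := integrableOn_lineβ hJ α
      γ_integrable := integrableOn_lineγ hJ α
      constr := fun _ _ _ => dualLine_le_lineγ_add_lineβ }
  α_slack := fun j => by rw [(hα.2 j).2, sub_self, mul_zero]
  β_slack := fun j t _ => lineβ_mul_sub hJ α j t
  γ_slack := fun t _ => lineγ_mul_sub α t
  R_slack := fun j t _ => lineR_mul_sub hJ α j t

/-- The total dual value of the resource used at time `t` by the line schedule of `α`. -/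
noncomputable def lineValue (J : JobSet n) (α : Fin n → ℝ) (t : ℝ) : ℝ :=
  ∑ j, J.lineR α j t * J.dualLine α j t

theorem lineR_mul_dualLine (j : Fin n) (t : ℝ) :
    J.lineR α j t * J.dualLine α j t =
      α j * J.lineR α j t - t * J.lineR α j t / J.v j := by
  unfold dualLine
  ring

theorem integrableOn_lineValue (hJ : J.NonDegenerate) (α : Fin n → ℝ) :
    IntegrableOn (J.lineValue α) (Ioi 0) := by
  unfold lineValue
  simp only [lineR_mul_dualLine]
  exact integrable_finsetSum _ fun j _ =>
    ((integrableOn_lineR hJ α j).const_mul _).sub (integrableOn_mul_lineR hJ α j)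

theorem integral_lineValue (hJ : J.NonDegenerate) (α : Fin n → ℝ) :
    ∫ t in Ioi (0 : ℝ), J.lineValue α t = J.objB (J.lineβ α) + objΓ (J.lineγ α) := by
  unfold lineValue
  simp only [sum_lineR_mul_dualLine hJ]
  have hβ : ∀ j ∈ Finset.univ, IntegrableOn (fun t => J.r j * J.lineβ α j t) (Ioi 0) :=
    fun j _ => (integrableOn_lineβ hJ α j).const_mul _
  rw [integral_add (integrable_finsetSum _ hβ) (integrableOn_lineγ hJ α),
    integral_finsetSum _ hβ]
  simp only [integral_const_mul, objB, objΓ]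

/-- Exact volumes enter here, turning `α j * ∫ R_j` into `α j * v j`. -/
theorem IsLSVector.integral_lineValue_eq_sub (hJ : J.NonDegenerate) (hα : J.IsLSVector α) :
    ∫ t in Ioi (0 : ℝ), J.lineValue α t = J.objA α - J.objP (J.lineR α) := by
  unfold lineValue
  simp only [lineR_mul_dualLine]
  have h := fun j => (integrableOn_lineR hJ α j).const_mul (α j)
  have hsub : ∀ j ∈ Finset.univ, IntegrableOn
      (fun t => α j * J.lineR α j t - t * J.lineR α j t / J.v j) (Ioi 0) :=
    fun j _ => (h j).sub (integrableOn_mul_lineR hJ α j)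
  rw [integral_finsetSum _ hsub, objA, objP, ← Finset.sum_sub_distrib]
  refine Finset.sum_congr rfl fun j _ => ?_
  rw [integral_sub (h j) (integrableOn_mul_lineR hJ α j), integral_const_mul, (hα.2 j).2]

/-- The assignment made at time `t` is an admissible competitor at time `c * t`, where each line has
dropped by `(c - 1) * t / v j`. -/
theorem lineValue_sub_le (hJ : J.NonDegenerate) (α : Fin n → ℝ) (c t : ℝ) :
    J.lineValue α t - (c - 1) * ∑ j, t * J.lineR α j t / J.v j ≤ J.lineValue α (c * t) := by
  refine le_of_eq_of_le ?_ (sum_mul_dualLine_le hJ α (c * t) (fun j => lineR_nonneg hJ α j t)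
    (fun j => lineR_le hJ α j t) (sum_lineR_le_one hJ α t))
  rw [lineValue, Finset.mul_sum, ← Finset.sum_sub_distrib]
  refine Finset.sum_congr rfl fun j _ => ?_
  unfold dualLine
  ring

/-- Rescaling time by `c` compares the value of a line schedule with its fractional completion
time. -/
theorem rescaling_inequality (hJ : J.NonDegenerate) (α : Fin n → ℝ) {c : ℝ} (hc : 0 < c) :
    (∫ t in Ioi (0 : ℝ), J.lineValue α t) - (c - 1) * J.objP (J.lineR α) ≤
      c⁻¹ * ∫ t in Ioi (0 : ℝ), J.lineValue α t := by
  have hP := fun j => integrableOn_mul_lineR hJ α j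
  have hs := (integrable_finsetSum Finset.univ fun j _ => hP j).const_mul (c - 1)
  have h1 : ∫ t in Ioi (0 : ℝ), J.lineValue α (c * t) =
      c⁻¹ * ∫ t in Ioi (0 : ℝ), J.lineValue α t := by
    rw [integral_comp_mul_left_Ioi (J.lineValue α) 0 hc, mul_zero, smul_eq_mul]
  have hW : IntegrableOn (fun t => J.lineValue α (c * t)) (Ioi 0) := by
    rw [integrableOn_Ioi_comp_mul_left_iff (J.lineValue α) 0 hc, mul_zero]
    exact integrableOn_lineValue hJ α
  rw [← h1, objP, ← integral_finsetSum _ fun j _ => hP j, ← integral_const_mul,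
    ← integral_sub (integrableOn_lineValue hJ α) hs]
  exact integral_mono ((integrableOn_lineValue hJ α).sub hs) hW
    fun t => lineValue_sub_le hJ α c t

/-- Multiplying by `c` gives `(c - 1) * (c * b - a) ≥ 0`, so `c * b` is at least `a` right of `1`
and at most `a` left of it. -/
theorem eq_of_forall_rescaling {a b : ℝ} (h : ∀ c : ℝ, 0 < c → a - (c - 1) * b ≤ c⁻¹ * a) :
    b = a := by
  have key : ∀ c : ℝ, 0 < c → 0 ≤ (c - 1) * (c * b - a) := fun c hc => by
    have h1 := mul_le_mul_of_nonneg_left (h c hc) hc.le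
    rw [mul_inv_cancel_left₀ hc.ne'] at h1
    linarith
  have hcont : Continuous fun c : ℝ => c * b := by fun_prop
  have hright : Filter.Tendsto (fun c : ℝ => c * b) (nhdsWithin 1 (Ioi 1)) (nhds b) := by
    simpa using (hcont.tendsto 1).mono_left nhdsWithin_le_nhds
  have hleft : Filter.Tendsto (fun c : ℝ => c * b) (nhdsWithin 1 (Iio 1)) (nhds b) := by
    simpa using (hcont.tendsto 1).mono_left nhdsWithin_le_nhds
  refine le_antisymm (le_of_tendsto hleft ?_) (ge_of_tendsto hright ?_)
  · filter_upwards [Ioo_mem_nhdsLT (zero_lt_one (α := ℝ))] with c hc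
    nlinarith [key c hc.1, hc.2]
  · filter_upwards [self_mem_nhdsWithin] with c hc
    have hc' : 1 < c := hc
    nlinarith [key c (by linarith)]

/-- Balancedness needs no volume condition, since rescaling only uses optimality at each time. -/
theorem objP_lineR_eq (hJ : J.NonDegenerate) (α : Fin n → ℝ) :
    J.objP (J.lineR α) = J.objB (J.lineβ α) + objΓ (J.lineγ α) := by
  rw [← integral_lineValue hJ α]
  exact eq_of_forall_rescaling fun c hc => rescaling_inequality hJ α hc

end Duality

/-! ### Existence of a vector with exact volumes -/

section Existence

variable {n : ℕ} {J : JobSet n}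

/-- The volume of job `j` processed by the line schedule of `α`. -/
noncomputable def lineVolume (J : JobSet n) (α : Fin n → ℝ) (j : Fin n) : ℝ :=
  ∫ t in Ioi (0 : ℝ), J.lineR α j t

/-- Raising the dual value of another job does not help job `i`. -/
theorem lineR_anti (hJ : J.NonDegenerate) {α α' : Fin n → ℝ} {i : Fin n} (hle : α ≤ α')
    (hi : α' i = α i) (t : ℝ) : J.lineR α' i t ≤ J.lineR α i t := by
  have hd : J.dualLine α' i t = J.dualLine α i t := by rw [dualLine, dualLine, hi]
  rw [lineR_closed hJ, lineR_closed hJ, hd]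
  split_ifs
  · gcongr
    · exact fun k _ _ => (J.r_pos k).le
    · intro k hk
      rw [mem_above] at hk ⊢
      have : J.dualLine α k t ≤ J.dualLine α' k t := by
        have := hle k
        unfold dualLine
        linarith
      unfold Higher at hk ⊢
      rw [hd]
      grind
  · exact le_rfl

theorem lineVolume_anti (hJ : J.NonDegenerate) {α α' : Fin n → ℝ} {i : Fin n} (hle : α ≤ α')
    (hi : α' i = α i) : J.lineVolume α' i ≤ J.lineVolume α i :=
  integral_mono (integrableOn_lineR hJ α' i) (integrableOn_lineR hJ α i)
    fun t => lineR_anti hJ hle hi t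

/-- Until its line hits zero at `α j * v j`, job `j` keeps total usage at `r j` or more. This bounds
`α` on `underfull`. -/
theorem le_sum_lineVolume (hJ : J.NonDegenerate) {α : Fin n → ℝ} {j : Fin n} (hj : 0 ≤ α j) :
    J.r j * (α j * J.v j) ≤ ∑ i, J.lineVolume α i := by
  have hT : 0 ≤ α j * J.v j := mul_nonneg hj (J.v_pos j).le
  have hint := integrable_finsetSum Finset.univ fun i _ => integrableOn_lineR hJ α i
  calc J.r j * (α j * J.v j) = ∫ _ in Ioo 0 (α j * J.v j), J.r j := by
        simp [hT, mul_comm]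
    _ ≤ ∫ t in Ioo 0 (α j * J.v j), ∑ i, J.lineR α i t := by
        refine setIntegral_mono_on (integrableOn_const (by simp))
          (IntegrableOn.mono_set hint Ioo_subset_Ioi_self) measurableSet_Ioo fun t ht => ?_
        exact le_sum_lineR hJ (dualLine_pos_iff.2 ht.2)
    _ ≤ ∫ t in Ioi 0, ∑ i, J.lineR α i t :=
        setIntegral_mono_set hint (Filter.Eventually.of_forall fun t =>
          Finset.sum_nonneg fun i _ => lineR_nonneg hJ α i t)
          Ioo_subset_Ioi_self.eventuallyLE
    _ = ∑ i, J.lineVolume α i := integral_finsetSum _ fun i _ => integrableOn_lineR hJ α i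

theorem continuous_dualLine (j : Fin n) (t : ℝ) :
    Continuous fun α : Fin n → ℝ => J.dualLine α j t := by
  unfold dualLine
  fun_prop

/-- At a time where no two of the dual lines and the zero line meet, the line schedule is locally
constant in `α`. -/
theorem eventually_lineR_eq (hJ : J.NonDegenerate) {α₀ : Fin n → ℝ} {t : ℝ}
    (h0 : ∀ i, J.dualLine α₀ i t ≠ 0)
    (h1 : ∀ i k, i ≠ k → J.dualLine α₀ i t ≠ J.dualLine α₀ k t) (j : Fin n) :
    ∀ᶠ α in nhds α₀, J.lineR α j t = J.lineR α₀ j t := by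
  have hpos : ∀ᶠ α in nhds α₀, (0 < J.dualLine α j t ↔ 0 < J.dualLine α₀ j t) := by
    rcases (h0 j).lt_or_gt with h | h
    · filter_upwards [(continuous_dualLine j t).continuousAt.eventually_lt
        continuousAt_const h] with α hα
      exact iff_of_false hα.not_gt h.not_gt
    · filter_upwards [continuousAt_const.eventually_lt
        (continuous_dualLine j t).continuousAt h] with α hα
      exact iff_of_true hα h
  have hhigh : ∀ᶠ α in nhds α₀, ∀ i, (J.Higher α t i j ↔ J.Higher α₀ t i j) := by
    refine Filter.eventually_all.2 fun i => ?_
    by_cases hij : i = j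
    · subst hij
      exact Filter.Eventually.of_forall fun α => iff_of_false Higher.irrefl Higher.irrefl
    · rcases (h1 i j hij).lt_or_gt with h | h
      · filter_upwards [(continuous_dualLine i t).continuousAt.eventually_lt
          (continuous_dualLine j t).continuousAt h] with α hα
        unfold Higher
        grind
      · filter_upwards [(continuous_dualLine j t).continuousAt.eventually_lt
          (continuous_dualLine i t).continuousAt h] with α hα
        exact iff_of_true (Or.inl hα) (Or.inl h)
  filter_upwards [hpos, hhigh] with α hα hα'
  have habove : J.above α t j = J.above α₀ t j := by
    ext i
    rw [mem_above, mem_above, hα' i]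
  rw [lineR_closed hJ, lineR_closed hJ, habove]
  simp only [hα]

/-- Distinct volumes mean distinct slopes, so two lines meet only once. -/
theorem ae_dualLine_ne (hJ : J.NonDegenerate) (α : Fin n → ℝ) :
    ∀ᵐ t : ℝ, (∀ i, J.dualLine α i t ≠ 0) ∧
      ∀ i k, i ≠ k → J.dualLine α i t ≠ J.dualLine α k t := by
  refine Filter.Eventually.and (Filter.eventually_all.2 fun i => ?_)
    (Filter.eventually_all.2 fun i => Filter.eventually_all.2 fun k => ?_)
  · filter_upwards [compl_mem_ae_iff.2 (measure_singleton (α i * J.v i))] with t ht h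
    refine ht ?_
    have := (J.v_pos i).ne'
    rw [mem_singleton_iff]
    unfold dualLine at h
    field_simp at h
    linarith
  · by_cases hik : i = k
    · exact Filter.Eventually.of_forall fun t h => absurd hik h
    have hne : (J.v i)⁻¹ - (J.v k)⁻¹ ≠ 0 :=
      sub_ne_zero.2 fun h => hJ i k hik (inv_injective h)
    filter_upwards [compl_mem_ae_iff.2
      (measure_singleton ((α i - α k) / ((J.v i)⁻¹ - (J.v k)⁻¹)))] with t ht _ h
    refine ht ?_
    rw [mem_singleton_iff, eq_div_iff hne]
    unfold dualLine at h
    simp only [div_eq_mul_inv] at h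
    linarith

theorem continuous_lineVolume (hJ : J.NonDegenerate) (j : Fin n) :
    Continuous fun α => J.lineVolume α j := by
  refine continuous_iff_continuousAt.2 fun α₀ => ?_
  refine continuousAt_of_dominated
    -- The slack `+ 1` gives one bounded support for all `α` near `α₀`.
    (bound := (Iic ((α₀ j + 1) * J.v j)).indicator fun _ => J.r j)
    (Filter.Eventually.of_forall fun α => (measurable_lineR hJ α j).aestronglyMeasurable)
    ?_ ?_ ?_
  · have hlt : ∀ᶠ α : Fin n → ℝ in nhds α₀, α j < α₀ j + 1 :=
      (continuous_apply j).continuousAt.eventually_lt continuousAt_const (lt_add_one (α₀ j))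
    filter_upwards [hlt] with α hα
    refine Filter.Eventually.of_forall fun t => ?_
    rw [Real.norm_of_nonneg (lineR_nonneg hJ α j t)]
    by_cases ht : t ∈ Iic ((α₀ j + 1) * J.v j)
    · rw [indicator_of_mem ht]
      exact lineR_le hJ α j t
    · rw [indicator_of_notMem ht, lineR_of_nonpos]
      refine not_lt.1 fun h => ht ((dualLine_pos_iff.1 h).le.trans ?_)
      exact mul_le_mul_of_nonneg_right hα.le (J.v_pos j).le
  · refine (integrable_indicator_iff measurableSet_Iic).2 ?_
    refine integrableOn_const ?_
    rw [Measure.restrict_apply measurableSet_Iic, Iic_inter_Ioi]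
    exact measure_Ioc_lt_top.ne
  · filter_upwards [ae_restrict_of_ae (ae_dualLine_ne hJ α₀)] with t ht
    exact continuousAt_const.congr
      ((eventually_lineR_eq hJ ht.1 ht.2 j).mono fun α h => h.symm)

/-- The dual values for which no job is processed beyond its volume. -/
def underfull (J : JobSet n) : Set (Fin n → ℝ) :=
  {α | (∀ j, 0 ≤ α j) ∧ ∀ j, J.lineVolume α j ≤ J.v j}

theorem isCompact_underfull (hJ : J.NonDegenerate) : IsCompact J.underfull := by
  have hclosed : IsClosed J.underfull := by
    have h : J.underfull = (⋂ j, {α | 0 ≤ α j}) ∩ ⋂ j, {α | J.lineVolume α j ≤ J.v j} := by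
      ext α
      simp [underfull]
    rw [h]
    exact (isClosed_iInter fun j => isClosed_le continuous_const (continuous_apply j)).inter
      (isClosed_iInter fun j => isClosed_le (continuous_lineVolume hJ j) continuous_const)
  refine (isCompact_Icc (a := (0 : Fin n → ℝ))
    (b := fun j => (∑ i, J.v i) / (J.r j * J.v j))).of_isClosed_subset hclosed ?_
  refine fun α hα => ⟨hα.1, fun j => ?_⟩
  rw [le_div_iff₀ (mul_pos (J.r_pos j) (J.v_pos j))]
  have h1 := le_sum_lineVolume hJ (hα.1 j)
  have h2 : ∑ i, J.lineVolume α i ≤ ∑ i, J.v i := Finset.sum_le_sum fun i _ => hα.2 i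
  linarith

theorem zero_mem_underfull (J : JobSet n) : (0 : Fin n → ℝ) ∈ J.underfull := by
  refine ⟨fun j => le_rfl, fun j => ?_⟩
  have h : J.lineVolume 0 j = 0 := by
    refine setIntegral_eq_zero_of_forall_eq_zero fun t ht => lineR_of_nonpos (not_lt.1 fun h => ?_)
    rw [dualLine_pos_iff, Pi.zero_apply, zero_mul] at h
    exact h.not_gt ht
  exact h.trans_le (J.v_pos j).le

theorem exists_isLSVector (hJ : J.NonDegenerate) : ∃ α : Fin n → ℝ, J.IsLSVector α := by
  obtain ⟨α, hα, hmax⟩ := (isCompact_underfull hJ).exists_isMaxOn ⟨0, J.zero_mem_underfull⟩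
    (f := fun α => ∑ j, α j) (by fun_prop)
  refine ⟨α, hα.1, fun j => ⟨integrableOn_lineR hJ α j, ?_⟩⟩
  by_contra hne
  have hlt : J.lineVolume α j < J.v j := lt_of_le_of_ne (hα.2 j) hne
  have hcont : Continuous fun x : ℝ => J.lineVolume (Function.update α j x) j :=
    (continuous_lineVolume hJ j).comp (continuous_const.update j continuous_id)
  have hev : ∀ᶠ x in nhds (α j), J.lineVolume (Function.update α j x) j < J.v j :=
    hcont.continuousAt.eventually_lt continuousAt_const
      (by rwa [Function.update_eq_self])
  -- Any `x` slightly above `α j` still leaves job `j` short of its volume.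
  obtain ⟨x, hxlt, hx⟩ :=
    ((hev.filter_mono (nhdsWithin_le_nhds (s := Ioi (α j)))).and self_mem_nhdsWithin).exists
  have hx' : α j < x := hx
  have hle : α ≤ Function.update α j x := le_update_iff.2 ⟨hx'.le, fun _ _ => le_rfl⟩
  have hmem : Function.update α j x ∈ J.underfull := by
    refine ⟨fun i => (hα.1 i).trans (hle i), fun i => ?_⟩
    by_cases hij : i = j
    · rw [hij]
      exact hxlt.le
    · exact (lineVolume_anti hJ hle (Function.update_of_ne hij _ _)).trans (hα.2 i)
  refine (hmax hmem).not_gt (Finset.sum_lt_sum (fun i _ => hle i) ⟨j, Finset.mem_univ j, ?_⟩)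
  rwa [Function.update_self]

end Existence

end JobSet

theorem mainTheorem7 {n : ℕ} (J : JobSet n) (hJ : J.NonDegenerate) :
    (∃ α : Fin n → ℝ, J.IsLSVector α) ∧
    ∀ α : Fin n → ℝ, J.IsLSVector α →
      J.IsPrimalDualPair (J.lineR α) α (J.lineβ α) (J.lineγ α) ∧
      (∀ j, MeasureTheory.IntegrableOn (fun t => t * J.lineR α j t / J.v j) (Set.Ioi 0)) ∧
      J.objA α = J.objB (J.lineβ α) + JobSet.objΓ (J.lineγ α) + J.objP (J.lineR α) ∧
      J.objP (J.lineR α) = J.objB (J.lineβ α) + JobSet.objΓ (J.lineγ α) := by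
  refine ⟨JobSet.exists_isLSVector hJ, fun α hα => ?_⟩
  have hbal := JobSet.objP_lineR_eq hJ α
  have h1 := JobSet.integral_lineValue hJ α
  have h2 := hα.integral_lineValue_eq_sub hJ
  exact ⟨hα.isPrimalDualPair hJ, JobSet.integrableOn_mul_lineR hJ α, by linarith, hbal⟩
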